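/- Let $I\subseteq(0,\infty)$ be a nonempty open interval and let $f,g:I\to\mathbb R$ be three times continuously differentiable functions such that $f(x)g(y)-f(y)g(x)\neq0$ for all distinct $x,y\in I$, the Wronskian $f'g-fg'$ does not vanish on $I$, and $g$ does not vanish on $I$. (Then $f/g$ is injective on $I$; $(f/g)^{-1}$ denotes its inverse.) Let $\mu$ be a probability measure on the Borel sets of $[0,1]$ whose second and third central moments $\mu_n=\int_{[0,1]}(t-\hat\mu_1)^n\,d\mu(t)$, $\hat\mu_1=\int_{[0,1]}t\,d\mu(t)$, satisfy $\mu_2\neq0$ and $\mu_3\neq0$. For $x,y\in I$ write $m_t=tx+(1-t)y$ and $$M(x,y)=\Big(\frac fg\Big)^{-1}\left(\frac{\int_{[0,1]}f(m_t)\,d\mu(t)}{\int_{[0,1]}g(m_t)\,d\mu(t)}\right).$$ Then $M(\lambda x,\lambda y)=\lambda M(x,y)$ holds for all $\lambda\in I/I=\{u/v\mid u,v\in I\}$ and all $x,y\in I$ with $\lambda x,\lambda y\in I$ if and only if there is a pair $(p,q)\in\mathbb C^2$ with $p+q\in\mathbb R$ and $pq\in\mathbb R$ (so that either $p,q\in\mathbb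 R$ or $p=\bar q=a+bi$ with $b\ne0$), and a number $c>0$, such that for all $x,y\in I$ $$M(x,y)=\begin{cases}\left(\dfrac{\int_{[0,1]}m_t^p\,d\mu(t)}{\int_{[0,1]}m_t^q\,d\mu(t)}\right)^{\frac1{p-q}}&\text{if }p,q\in\mathbb R,\ p\neq q,\\[4mm]\exp\left(\dfrac{\int_{[0,1]}m_t^p\log(m_t)\,d\mu(t)}{\int_{[0,1]}m_t^p\,d\mu(t)}\right)&\text{if }p=q\in\mathbb R,\\[4mm]c\exp\left(\dfrac1b\arctan\left(\dfrac{\int_{[0,1]}m_t^a\sin(b\log(m_t/c))\,d\mu(t)}{\int_{[0,1]}m_t^a\cos(b\log(m_t/c))\,d\mu(t)}\right)\right)&\text{if }p=\bar q=a+bi,\ b\neq0,\end{cases}$$ where, in the last case, $I\subseteq\big(c\,e^{-\pi/(2|b|)},\,c\,e^{\pi/(2|b|)}\big)$. Moreover, if in the last case the formula holds on $I^2$ for one $c>0$ satisfying this inclusion, then it holds for every $c>0$ satisfying it; in particular $c=1$ can be taken whenever $I\subseteq\big(e^{-\pi/(2|b|)},e^{\pi/(2|b|)}\big)$. -/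

import Mathlib

open scoped Pointwise

/-- `(f, g)` is a two-dimensional Chebyshev system on `I`: both functions are continuous and the
determinant `f x * g y - f y * g x` is nonzero for distinct points `x, y` of `I`. -/
def IsChebyshevSystem (I : Set ℝ) (f g : ℝ → ℝ) : Prop :=
  ContinuousOn f I ∧ ContinuousOn g I ∧
    ∀ x ∈ I, ∀ y ∈ I, x ≠ y → f x * g y - f y * g x ≠ 0

/-- The class `C_n(I)` (for an open interval `I`): Chebyshev systems of `n` times continuously
differentiable functions whose Wronski determinant, if `n ≥ 1`, does not vanish on `I`. -/
structure IsChebyshevClass (n : ℕ) (I : Set ℝ) (f g : ℝ → ℝ) : Prop where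
  contDiffOn_left : ContDiffOn ℝ n f I
  contDiffOn_right : ContDiffOn ℝ n g I
  chebyshev : IsChebyshevSystem I f g
  wronskian_ne_zero : 1 ≤ n → ∀ x ∈ I, deriv f x * g x - f x * deriv g x ≠ 0

/-- The weighted arithmetic mean `t x + (1 - t) y`, `t ∈ [0, 1]`. -/
def segMean (x y : ℝ) (t : unitInterval) : ℝ := (t : ℝ) * x + (1 - (t : ℝ)) * y

/-- The two-variable integral Bajraktarević mean
`(f / g)⁻¹ (∫ f (t x + (1 - t) y) dμ(t) / ∫ g (t x + (1 - t) y) dμ(t))`,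
where `(f / g)⁻¹` is the inverse of the restriction of `f / g` to `I`. -/
noncomputable def bajMean (I : Set ℝ) (f g : ℝ → ℝ) (μ : MeasureTheory.Measure unitInterval)
    (x y : ℝ) : ℝ :=
  Function.invFunOn (fun u => f u / g u) I
    ((∫ t, f (segMean x y t) ∂μ) / (∫ t, g (segMean x y t) ∂μ))

/-- Homogeneity of a two-variable mean on `I`: `M (l x, l y) = l M (x, y)` for every ratio `l` of
elements of `I`, and all `x, y ∈ I` for which `l x, l y ∈ I` too. -/
def IsHomogeneousMean (I : Set ℝ) (M : ℝ → ℝ → ℝ) : Prop :=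
  ∀ l ∈ I / I, ∀ x ∈ I, ∀ y ∈ I, l * x ∈ I → l * y ∈ I → M (l * x) (l * y) = l * M x y

/-- The pairs of complex numbers whose sum and product are real, i.e. `p` and `q` are both real
or they are complex conjugates. -/
def IsGiniPair (p q : ℂ) : Prop := (p + q).im = 0 ∧ (p * q).im = 0

/-- For `p = a + b i` with `b ≠ 0`: the interval `I` is contained in
`(c exp (-π / (2|b|)), c exp (π / (2|b|)))`. For real `p` nothing but `c > 0` is required. -/
def IsGiniScale (I : Set ℝ) (p : ℂ) (c : ℝ) : Prop :=
  0 < c ∧ (p.im ≠ 0 →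
    I ⊆ Set.Ioo (c * Real.exp (-(Real.pi / (2 * |p.im|))))
      (c * Real.exp (Real.pi / (2 * |p.im|))))

/-- The explicit two-variable integral Gini mean of a pair `(p, q)` with real sum and product.
In the last case `q` is the conjugate of `p = a + b i`, `b ≠ 0`, and the scale `c` normalizes the
argument of the logarithm; `c = 1` gives the usual formula. The first two cases do not
depend on `c`. -/
noncomputable def giniMean (μ : MeasureTheory.Measure unitInterval) (c : ℝ) (p q : ℂ)
    (x y : ℝ) : ℝ :=
  if p.im = 0 then
    if p = q then
      Real.exp ((∫ t, segMean x y t ^ p.re * Real.log (segMean x y t) ∂μ) /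
        (∫ t, segMean x y t ^ p.re ∂μ))
    else
      ((∫ t, segMean x y t ^ p.re ∂μ) / (∫ t, segMean x y t ^ q.re ∂μ)) ^ (1 / (p.re - q.re))
  else
    c * Real.exp (1 / p.im * Real.arctan
      ((∫ t, segMean x y t ^ p.re * Real.sin (p.im * Real.log (segMean x y t / c)) ∂μ) /
        (∫ t, segMean x y t ^ p.re * Real.cos (p.im * Real.log (segMean x y t / c)) ∂μ)))

section Development

open MeasureTheory Set Filter Topology Asymptotics ProbabilityTheory

/-! Put K(u,v) = f(u)g(v) - f(v)g(u). Then M(x,y) is the unique ξ in I with ∫ K(m_t, ξ) dμ(t) = 0,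
so the mean depends on (f, g) only through K, and multiplying K by a nonzero constant changes
nothing. The Gini means have the same description with `giniKernel`, which does not involve c and is
multiplied by a constant under (u,v) ↦ (lu,lv). This gives both sufficiency and independence of the
scale.

For necessity, let W = f'g - fg' and let m be the first moment of μ. For small s, M(z+(1-m)s, z-ms)
= z + (μ₂/2) Φ(z) s² + (μ₃/6) Ψ(z) s³ + o(s³), where Φ = (f''g - fg'')/W and Ψ = (f'''g - fg''')/W
(`bajMean_isLittleO`). Since μ₂ and μ₃ are nonzero, homogeneity makes uΦ(u) and u²Ψ(u) constant
(`IsHomogeneousMean.invariants_mul`). Hence f and g solve one Euler equation u²y'' = αuy' + βy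
(`isEulerSolution_of_determinants`). By the sign of its discriminant, the solutions are spanned by
powers, a power and its product with log, or a power times sine and cosine of a multiple of log. So
K is a multiple of a Gini kernel (`IsEulerSolution.exists_giniKernel`). In the complex case the
Chebyshev property bounds the logarithmic length of I, which provides an admissible c
(`exists_isGiniScale`). -/

theorem continuous_segMean (x y : ℝ) : Continuous (segMean x y) := by
  unfold segMean
  fun_prop

theorem segMean_mem_uIcc (x y : ℝ) (t : unitInterval) : segMean x y t ∈ uIcc x y := by
  rw [← segment_eq_uIcc]
  exact ⟨t, 1 - t, t.2.1, sub_nonneg.2 t.2.2, by ring, rfl⟩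

theorem segMean_mul (l x y : ℝ) (t : unitInterval) :
    segMean (l * x) (l * y) t = l * segMean x y t := by
  unfold segMean
  ring

/-! ### Means as zeros of averaged kernels -/

section Mean

variable {I : Set ℝ} {x y : ℝ}

theorem continuous_comp_segMean {F : ℝ → ℝ} (hF : ContinuousOn F (uIcc x y)) :
    Continuous fun t => F (segMean x y t) :=
  hF.comp_continuous (continuous_segMean x y) (segMean_mem_uIcc x y)

variable {μ : Measure unitInterval} [IsProbabilityMeasure μ]

theorem integrable_of_continuous_unitInterval {F : unitInterval → ℝ} (hF : Continuous F) :
    Integrable F μ :=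
  hF.integrable_of_hasCompactSupport (HasCompactSupport.of_compactSpace F)

theorem integrable_comp_segMean {F : ℝ → ℝ} (hF : ContinuousOn F (uIcc x y)) :
    Integrable (fun t => F (segMean x y t)) μ :=
  integrable_of_continuous_unitInterval (continuous_comp_segMean hF)

theorem integral_comp_segMean_pos {F : ℝ → ℝ} (hF : ContinuousOn F (uIcc x y))
    (hpos : ∀ u ∈ uIcc x y, 0 < F u) : 0 < ∫ t, F (segMean x y t) ∂μ := by
  have hp : ∀ t, 0 < F (segMean x y t) := fun t => hpos _ (segMean_mem_uIcc x y t)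
  rw [integral_pos_iff_support_of_nonneg (fun t => (hp t).le) (integrable_comp_segMean hF)]
  have : Function.support (fun t => F (segMean x y t)) = univ :=
    Set.eq_univ_of_forall fun t => (hp t).ne'
  rw [this]
  simp

theorem integral_comp_segMean_ne_zero {F : ℝ → ℝ} (hF : ContinuousOn F (uIcc x y))
    (h0 : ∀ u ∈ uIcc x y, F u ≠ 0) : ∫ t, F (segMean x y t) ∂μ ≠ 0 := by
  -- A continuous function without zeros on a segment has constant sign.
  have key : (∀ u ∈ uIcc x y, 0 < F u) ∨ ∀ u ∈ uIcc x y, F u < 0 := by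
    by_contra! h
    obtain ⟨⟨u, hu, hu'⟩, v, hv, hv'⟩ := h
    obtain ⟨w, hw, hw'⟩ := isPreconnected_uIcc.intermediate_value hu hv hF ⟨hu', hv'⟩
    exact h0 w hw hw'
  rcases key with h | h
  · exact (integral_comp_segMean_pos hF h).ne'
  · have := integral_comp_segMean_pos (μ := μ) hF.neg fun u hu => neg_pos.2 (h u hu)
    simp only [Pi.neg_apply, integral_neg] at this
    exact (neg_pos.1 this).ne

/-- Mean value theorem for the quotient of two averages over a segment. -/
theorem exists_mem_uIcc_integral_eq {f g : ℝ → ℝ} (hf : ContinuousOn f (uIcc x y))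
    (hg : ContinuousOn g (uIcc x y)) (h0 : ∀ u ∈ uIcc x y, g u ≠ 0) :
    ∃ ξ ∈ uIcc x y,
      (∫ t, f (segMean x y t) ∂μ) * g ξ = f ξ * ∫ t, g (segMean x y t) ∂μ := by
  have hG := integral_comp_segMean_ne_zero (μ := μ) hg h0
  by_contra! h
  refine integral_comp_segMean_ne_zero (μ := μ) (x := x) (y := y)
    (F := fun u => (∫ t, f (segMean x y t) ∂μ) * g u - f u * ∫ t, g (segMean x y t) ∂μ)
    (by fun_prop) (fun u hu => sub_ne_zero.2 (h u hu)) ?_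
  rw [integral_sub ((integrable_comp_segMean hg).const_mul _)
    ((integrable_comp_segMean hf).mul_const _), integral_const_mul, integral_mul_const, sub_self]

/-- A point is the Bajraktarević mean as soon as it balances the two averages. -/
theorem bajMean_eq_of_balance {f g : ℝ → ℝ} (hI : I.OrdConnected) (hfg : IsChebyshevSystem I f g)
    (hg : ∀ u ∈ I, g u ≠ 0) (hx : x ∈ I) (hy : y ∈ I) {ξ : ℝ} (hξ : ξ ∈ I)
    (h : (∫ t, f (segMean x y t) ∂μ) * g ξ = f ξ * ∫ t, g (segMean x y t) ∂μ) :
    bajMean I f g μ x y = ξ := by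
  have hG := integral_comp_segMean_ne_zero (μ := μ) (hfg.2.1.mono (hI.uIcc_subset hx hy))
    fun u hu => hg u (hI.uIcc_subset hx hy hu)
  have hinj : InjOn (fun u => f u / g u) I := by
    intro u hu v hv huv
    by_contra hne
    have := hfg.2.2 u hu v hv hne
    rw [div_eq_div_iff (hg u hu) (hg v hv)] at huv
    exact this (sub_eq_zero.2 huv)
  have : (∫ t, f (segMean x y t) ∂μ) / (∫ t, g (segMean x y t) ∂μ) = f ξ / g ξ := by
    rw [div_eq_div_iff hG (hg ξ hξ), h]
  unfold bajMean
  rw [this]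
  exact hinj.leftInvOn_invFunOn hξ

/-- The mean value theorem supplies a balancing point and injectivity of f/g identifies it with the
mean. From here on the inverse function is no longer needed. -/
theorem exists_bajMean_balance {f g : ℝ → ℝ} (hI : I.OrdConnected)
    (hfg : IsChebyshevSystem I f g) (hg : ∀ u ∈ I, g u ≠ 0) (hx : x ∈ I) (hy : y ∈ I) :
    bajMean I f g μ x y ∈ uIcc x y ∧ (∫ t, f (segMean x y t) ∂μ) * g (bajMean I f g μ x y) =
      f (bajMean I f g μ x y) * ∫ t, g (segMean x y t) ∂μ := by
  have hs := hI.uIcc_subset hx hy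
  obtain ⟨ξ, hξ, h⟩ := exists_mem_uIcc_integral_eq (μ := μ) (hfg.1.mono hs) (hfg.2.1.mono hs)
    fun u hu => hg u (hs hu)
  rw [bajMean_eq_of_balance hI hfg hg hx hy (hs hξ) h]
  exact ⟨hξ, h⟩

end Mean

/-! ### Gini means and their kernels -/

/-- The numerator of the quotient whose quasi-inverse is the Gini mean of `(p, q)`. -/
noncomputable def giniNum (c : ℝ) (p q : ℂ) (u : ℝ) : ℝ :=
  if p.im = 0 then if p = q then u ^ p.re * Real.log u else u ^ p.re
  else u ^ p.re * Real.sin (p.im * Real.log (u / c))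

/-- The denominator of the quotient whose quasi-inverse is the Gini mean of `(p, q)`. -/
noncomputable def giniDen (c : ℝ) (p q : ℂ) (u : ℝ) : ℝ :=
  if p.im = 0 then if p = q then u ^ p.re else u ^ q.re
  else u ^ p.re * Real.cos (p.im * Real.log (u / c))

/-- The antisymmetric kernel of the Gini mean of `(p, q)`. -/
noncomputable def giniKernel (p q : ℂ) (u v : ℝ) : ℝ :=
  if p.im = 0 then
    if p = q then u ^ p.re * v ^ p.re * (Real.log u - Real.log v)
    else u ^ p.re * v ^ q.re - u ^ q.re * v ^ p.re
  else u ^ p.re * v ^ p.re * Real.sin (p.im * (Real.log u - Real.log v))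

/-- In the complex case this is the subtraction formula for sine; log c cancels, so the kernel is
free of the scale. -/
theorem giniKernel_eq {c : ℝ} (hc : 0 < c) (p q : ℂ) {u v : ℝ} (hu : 0 < u) (hv : 0 < v) :
    giniKernel p q u v = giniNum c p q u * giniDen c p q v - giniNum c p q v * giniDen c p q u := by
  unfold giniKernel giniNum giniDen
  split_ifs with h1 h2
  · ring
  · ring
  · have : p.im * (Real.log u - Real.log v) =
        p.im * Real.log (u / c) - p.im * Real.log (v / c) := by
      rw [Real.log_div hu.ne' hc.ne', Real.log_div hv.ne' hc.ne']
      ring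
    rw [this, Real.sin_sub]
    ring

theorem IsGiniPair.re_ne {p q : ℂ} (h : IsGiniPair p q) (hp : p.im = 0) (hpq : p ≠ q) :
    p.re - q.re ≠ 0 := by
  intro h0
  have h1 := h.1
  rw [Complex.add_im] at h1
  exact hpq (Complex.ext (by linarith) (by linarith))

/-- The factor r is l^(p+q). It does not depend on w, so it leaves the integral over the segment. -/
theorem giniKernel_mul (p q : ℂ) {l v : ℝ} (hl : 0 < l) (hv : 0 < v) :
    ∃ r : ℝ, ∀ w > 0, giniKernel p q (l * w) (l * v) = r * giniKernel p q w v := by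
  unfold giniKernel
  split_ifs with h1 h2
  · refine ⟨l ^ p.re * l ^ p.re, fun w hw => ?_⟩
    rw [Real.mul_rpow hl.le hw.le, Real.mul_rpow hl.le hv.le, Real.log_mul hl.ne' hw.ne',
      Real.log_mul hl.ne' hv.ne']
    ring
  · refine ⟨l ^ p.re * l ^ q.re, fun w hw => ?_⟩
    rw [Real.mul_rpow hl.le hw.le, Real.mul_rpow hl.le hv.le, Real.mul_rpow hl.le hw.le,
      Real.mul_rpow hl.le hv.le]
    ring
  · refine ⟨l ^ p.re * l ^ p.re, fun w hw => ?_⟩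
    rw [Real.mul_rpow hl.le hw.le, Real.mul_rpow hl.le hv.le, Real.log_mul hl.ne' hw.ne',
      Real.log_mul hl.ne' hv.ne', add_sub_add_left_eq_sub]
    ring

section Gini

variable {I : Set ℝ} {p q : ℂ} {c : ℝ}

theorem continuousOn_giniNum (hI : I ⊆ Ioi 0) (hc : 0 < c) : ContinuousOn (giniNum c p q) I := by
  have h0 : ∀ u ∈ I, u ≠ 0 := fun u hu => (hI hu).ne'
  have h1 : ∀ u ∈ I, u / c ≠ 0 := fun u hu => div_ne_zero (h0 u hu) hc.ne'
  unfold giniNum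
  have h2 : ∀ a : ℝ, ContinuousOn (fun u : ℝ => u ^ a) I := fun a =>
    continuousOn_id.rpow_const fun u hu => Or.inl (h0 u hu)
  have h3 : ContinuousOn Real.log I := continuousOn_id.log h0
  have h4 : ContinuousOn (fun u => Real.log (u / c)) I :=
    (continuousOn_id.div_const c).log h1
  split_ifs
  · exact (h2 _).mul h3
  · exact h2 _
  · exact (h2 _).mul (Real.continuous_sin.comp_continuousOn (h4.const_mul _))

theorem continuousOn_giniDen (hI : I ⊆ Ioi 0) (hc : 0 < c) : ContinuousOn (giniDen c p q) I := by
  have h0 : ∀ u ∈ I, u ≠ 0 := fun u hu => (hI hu).ne'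
  have h1 : ∀ u ∈ I, u / c ≠ 0 := fun u hu => div_ne_zero (h0 u hu) hc.ne'
  unfold giniDen
  have h2 : ∀ a : ℝ, ContinuousOn (fun u : ℝ => u ^ a) I := fun a =>
    continuousOn_id.rpow_const fun u hu => Or.inl (h0 u hu)
  have h4 : ContinuousOn (fun u => Real.log (u / c)) I :=
    (continuousOn_id.div_const c).log h1
  split_ifs
  · exact h2 _
  · exact h2 _
  · exact (h2 _).mul (Real.continuous_cos.comp_continuousOn (h4.const_mul _))

theorem IsGiniScale.angle_mem (h : IsGiniScale I p c) (hp : p.im ≠ 0) {u : ℝ} (hu : u ∈ I) :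
    p.im * Real.log (u / c) ∈ Ioo (-(Real.pi / 2)) (Real.pi / 2) := by
  obtain ⟨h1, h2⟩ := h.2 hp hu
  have hc := h.1
  have hb : 0 < |p.im| := abs_pos.2 hp
  have hu0 : 0 < u / c := div_pos (lt_trans (by positivity) h1) hc
  rw [mul_comm, ← lt_div_iff₀ hc] at h1
  rw [mul_comm, ← div_lt_iff₀ hc] at h2
  rw [← Real.lt_log_iff_exp_lt hu0] at h1
  rw [← Real.log_lt_iff_lt_exp hu0] at h2
  have h3 : |Real.log (u / c)| < Real.pi / (2 * |p.im|) := abs_lt.2 ⟨h1, h2⟩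
  rw [mem_Ioo, ← abs_lt, abs_mul]
  calc |p.im| * |Real.log (u / c)| < |p.im| * (Real.pi / (2 * |p.im|)) := by gcongr
    _ = Real.pi / 2 := by field_simp

theorem giniDen_pos (hI : I ⊆ Ioi 0) (h : IsGiniScale I p c) {u : ℝ} (hu : u ∈ I) :
    0 < giniDen c p q u := by
  have hu0 : 0 < u := hI hu
  unfold giniDen
  split_ifs with hp hpq
  · positivity
  · positivity
  · exact mul_pos (by positivity) (Real.cos_pos_of_mem_Ioo (h.angle_mem hp hu))

variable {μ : Measure unitInterval} [IsProbabilityMeasure μ] {x y : ℝ}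

theorem integral_giniKernel (hI : I ⊆ Ioi 0) (hI' : I.OrdConnected) (hc : 0 < c) (hx : x ∈ I)
    (hy : y ∈ I) {ξ : ℝ} (hξ : ξ ∈ I) :
    ∫ t, giniKernel p q (segMean x y t) ξ ∂μ =
      (∫ t, giniNum c p q (segMean x y t) ∂μ) * giniDen c p q ξ -
        giniNum c p q ξ * ∫ t, giniDen c p q (segMean x y t) ∂μ := by
  have hs := hI'.uIcc_subset hx hy
  have h1 : ∀ t, giniKernel p q (segMean x y t) ξ =
      giniNum c p q (segMean x y t) * giniDen c p q ξ -
        giniNum c p q ξ * giniDen c p q (segMean x y t) := fun t =>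
    giniKernel_eq hc p q (hI (hs (segMean_mem_uIcc x y t))) (hI hξ)
  simp only [h1]
  rw [integral_sub ((integrable_comp_segMean ((continuousOn_giniNum hI hc).mono hs)).mul_const _)
    ((integrable_comp_segMean ((continuousOn_giniDen hI hc).mono hs)).const_mul _),
    integral_mul_const, integral_const_mul]

/-- A point is the Gini mean as soon as the kernel averages to zero there. -/
theorem giniMean_eq_of_integral_eq_zero (hI : I ⊆ Ioi 0) (hI' : I.OrdConnected)
    (hpq : IsGiniPair p q) (hc : IsGiniScale I p c) (hx : x ∈ I) (hy : y ∈ I) {ξ : ℝ}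
    (hξ : ξ ∈ I) (h : ∫ t, giniKernel p q (segMean x y t) ξ ∂μ = 0) :
    giniMean μ c p q x y = ξ := by
  have hs := hI'.uIcc_subset hx hy
  have hD : 0 < ∫ t, giniDen c p q (segMean x y t) ∂μ :=
    integral_comp_segMean_pos ((continuousOn_giniDen hI hc.1).mono hs)
      fun u hu => giniDen_pos hI hc (hs hu)
  rw [integral_giniKernel hI hI' hc.1 hx hy hξ, sub_eq_zero] at h
  have hq : (∫ t, giniNum c p q (segMean x y t) ∂μ) / (∫ t, giniDen c p q (segMean x y t) ∂μ) =
      giniNum c p q ξ / giniDen c p q ξ := by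
    rw [div_eq_div_iff hD.ne' (giniDen_pos hI hc hξ).ne', h]
  have hξ0 : 0 < ξ := hI hξ
  unfold giniNum giniDen at hq
  unfold giniMean
  split_ifs at hq ⊢ with h1 h2
  · rw [hq, mul_div_cancel_left₀ _ (by positivity), Real.exp_log hξ0]
  · rw [hq, ← Real.rpow_sub hξ0, ← Real.rpow_mul hξ0.le, mul_one_div_cancel (hpq.re_ne h1 h2),
      Real.rpow_one]
  -- The scale condition keeps the angle in (-π/2, π/2), where arctan inverts tan.
  · have ha := hc.angle_mem h1 hξ
    rw [hq, mul_div_mul_left _ _ (by positivity), ← Real.tan_eq_sin_div_cos,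
      Real.arctan_tan ha.1 ha.2, ← mul_assoc, one_div_mul_cancel h1, one_mul,
      Real.exp_log (div_pos hξ0 hc.1), mul_div_cancel₀ _ hc.1.ne']

theorem giniMean_mem_and_integral_eq_zero (hI : I ⊆ Ioi 0) (hI' : I.OrdConnected)
    (hpq : IsGiniPair p q) (hc : IsGiniScale I p c) (hx : x ∈ I) (hy : y ∈ I) :
    giniMean μ c p q x y ∈ uIcc x y ∧
      ∫ t, giniKernel p q (segMean x y t) (giniMean μ c p q x y) ∂μ = 0 := by
  have hs := hI'.uIcc_subset hx hy
  obtain ⟨ξ, hξ, h⟩ := exists_mem_uIcc_integral_eq (μ := μ)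
    ((continuousOn_giniNum (p := p) (q := q) hI hc.1).mono hs)
    ((continuousOn_giniDen (p := p) (q := q) hI hc.1).mono hs)
    fun u hu => (giniDen_pos hI hc (hs hu)).ne'
  have h0 : ∫ t, giniKernel p q (segMean x y t) ξ ∂μ = 0 := by
    rw [integral_giniKernel hI hI' hc.1 hx hy (hs hξ), h, sub_self]
  rw [giniMean_eq_of_integral_eq_zero hI hI' hpq hc hx hy (hs hξ) h0]
  exact ⟨hξ, h0⟩

/-- Both means are characterized by the zero of the same c-free averaged kernel. -/
theorem giniMean_eq_giniMean (hI : I ⊆ Ioi 0) (hI' : I.OrdConnected)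
    (hpq : IsGiniPair p q) (hc : IsGiniScale I p c) {c' : ℝ} (hc' : IsGiniScale I p c')
    (hx : x ∈ I) (hy : y ∈ I) : giniMean μ c p q x y = giniMean μ c' p q x y := by
  obtain ⟨h1, h2⟩ := giniMean_mem_and_integral_eq_zero (μ := μ) hI hI' hpq hc hx hy
  exact (giniMean_eq_of_integral_eq_zero hI hI' hpq hc' hx hy
    (hI'.uIcc_subset hx hy h1) h2).symm

theorem giniMean_mul (hI : I ⊆ Ioi 0) (hI' : I.OrdConnected)
    (hpq : IsGiniPair p q) (hc : IsGiniScale I p c) (hx : x ∈ I) (hy : y ∈ I) {l : ℝ}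
    (hl : 0 < l) (hlx : l * x ∈ I) (hly : l * y ∈ I) :
    giniMean μ c p q (l * x) (l * y) = l * giniMean μ c p q x y := by
  obtain ⟨h1, h2⟩ := giniMean_mem_and_integral_eq_zero (μ := μ) hI hI' hpq hc hx hy
  have hs := hI'.uIcc_subset hx hy
  set ξ := giniMean μ c p q x y
  refine giniMean_eq_of_integral_eq_zero hI hI' hpq hc hlx hly ?_ ?_
  · refine hI'.uIcc_subset hlx hly ?_
    rw [mem_uIcc] at h1 ⊢
    rcases h1 with h | h
    · exact Or.inl ⟨by nlinarith [h.1], by nlinarith [h.2]⟩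
    · exact Or.inr ⟨by nlinarith [h.1], by nlinarith [h.2]⟩
  · obtain ⟨r, hr⟩ := giniKernel_mul p q hl (hI (hs h1))
    have : ∀ t, giniKernel p q (segMean (l * x) (l * y) t) (l * ξ) =
        r * giniKernel p q (segMean x y t) ξ := fun t => by
      rw [segMean_mul, hr _ (hI (hs (segMean_mem_uIcc x y t)))]
    simp only [this, integral_const_mul, h2, mul_zero]

end Gini

/-! ### Euler equations and their fundamental systems -/

section Euler

variable {I : Set ℝ}

theorem exists_eq_mul_rpow_of_hasDerivAt (hIo : IsOpen I) (hIc : I.OrdConnected) (hI : I ⊆ Ioi 0)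
    {w : ℝ → ℝ} {α : ℝ} (hw : ∀ x ∈ I, HasDerivAt w (α / x * w x) x) :
    ∃ C : ℝ, ∀ x ∈ I, w x = C * x ^ α := by
  have hd : ∀ x ∈ I, HasDerivAt (fun x => w x * x ^ (-α)) 0 x := fun x hx => by
    have hx0 : 0 < x := hI hx
    have h := (hw x hx).mul (Real.hasDerivAt_rpow_const (p := -α) (Or.inl hx0.ne'))
    refine h.congr_deriv ?_
    rw [Real.rpow_sub_one hx0.ne']
    field_simp
    ring
  obtain ⟨C, hC⟩ := hIo.exists_is_const_of_deriv_eq_zero hIc.isPreconnected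
    (fun x hx => (hd x hx).differentiableAt.differentiableWithinAt) (fun x hx => (hd x hx).deriv)
  refine ⟨C, fun x hx => ?_⟩
  have hx0 : 0 < x := hI hx
  rw [← hC x hx, mul_assoc, ← Real.rpow_add hx0, neg_add_cancel, Real.rpow_zero, mul_one]

/-- A function `y` is a solution on `I` of the Euler equation `x² y'' = α x y' + β y`. -/
structure IsEulerSolution (I : Set ℝ) (α β : ℝ) (y y' : ℝ → ℝ) : Prop where
  hasDerivAt : ∀ x ∈ I, HasDerivAt y (y' x) x
  hasDerivAt_deriv : ∀ x ∈ I, HasDerivAt y' (α / x * y' x + β / x ^ 2 * y x) x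

variable {α β : ℝ}

/-- Abel's identity: the Wronskian w satisfies w' = (α/x) w. -/
theorem IsEulerSolution.exists_wronskian_eq (hIo : IsOpen I) (hIc : I.OrdConnected)
    (hI : I ⊆ Ioi 0) {y y' z z' : ℝ → ℝ} (hy : IsEulerSolution I α β y y')
    (hz : IsEulerSolution I α β z z') :
    ∃ C : ℝ, ∀ x ∈ I, y' x * z x - y x * z' x = C * x ^ α := by
  refine exists_eq_mul_rpow_of_hasDerivAt hIo hIc hI fun x hx => ?_
  have h := ((hy.hasDerivAt_deriv x hx).mul (hz.hasDerivAt x hx)).sub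
    ((hy.hasDerivAt x hx).mul (hz.hasDerivAt_deriv x hx))
  refine h.congr_deriv ?_
  ring

/-- Two functions satisfying a first order Euler system solve the Euler equation given by the
trace and the determinant of the system. -/
theorem isEulerSolution_of_system {a b c d : ℝ} (hI : I ⊆ Ioi 0) {y z : ℝ → ℝ}
    (hy : ∀ x ∈ I, HasDerivAt y ((a * y x + b * z x) / x) x)
    (hz : ∀ x ∈ I, HasDerivAt z ((c * y x + d * z x) / x) x) (htr : a + d = 1 + α)
    (hdet : a * d - b * c = -β) :
    IsEulerSolution I α β y (fun x => (a * y x + b * z x) / x) where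
  hasDerivAt := hy
  hasDerivAt_deriv x hx := by
    have hx0 : x ≠ 0 := (hI hx).ne'
    have h := (((hy x hx).const_mul a).add ((hz x hx).const_mul b)).div (hasDerivAt_id x) hx0
    refine h.congr_deriv ?_
    obtain rfl : α = a + d - 1 := by linarith
    obtain rfl : β = b * c - a * d := by linarith
    simp only [id, Pi.add_apply]
    field_simp
    ring

/-- Cramer's rule: all three Wronskians are multiples of the same x^α, so their quotients are
constants. The final identity expands a 3×3 determinant with a repeated row. -/
theorem IsEulerSolution.exists_eq_linear_combination (hIo : IsOpen I) (hIc : I.OrdConnected)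
    (hI : I ⊆ Ioi 0) {y y' φ φ' ψ ψ' : ℝ → ℝ} (hy : IsEulerSolution I α β y y')
    (hφ : IsEulerSolution I α β φ φ') (hψ : IsEulerSolution I α β ψ ψ')
    (hW : ∀ x ∈ I, φ' x * ψ x - φ x * ψ' x ≠ 0) :
    ∃ A B : ℝ, ∀ x ∈ I, y x = A * φ x + B * ψ x := by
  obtain ⟨C₁, h₁⟩ := hy.exists_wronskian_eq hIo hIc hI hφ
  obtain ⟨C₂, h₂⟩ := hy.exists_wronskian_eq hIo hIc hI hψ
  obtain ⟨C₀, h₀⟩ := hφ.exists_wronskian_eq hIo hIc hI hψ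
  refine ⟨C₂ / C₀, -(C₁ / C₀), fun x hx => ?_⟩
  have e₁ := h₁ x hx
  have e₂ := h₂ x hx
  have e₀ := h₀ x hx
  have hne := hW x hx
  have hC : C₀ ≠ 0 := by
    rintro rfl
    exact hne (by rw [e₀, zero_mul])
  have hx0 : 0 < x ^ α := Real.rpow_pos_of_pos (hI hx) _
  field_simp
  refine mul_right_cancel₀ hx0.ne' ?_
  linear_combination y x * -e₀ - ψ x * e₁ + φ x * e₂

/-- Two solutions of the same Euler equation have a multiple of a Gini kernel as determinant. -/
theorem IsEulerSolution.exists_giniKernel (hIo : IsOpen I) (hIc : I.OrdConnected)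
    (hI : I ⊆ Ioi 0) {f f' g g' : ℝ → ℝ} (hf : IsEulerSolution I α β f f')
    (hg : IsEulerSolution I α β g g') :
    ∃ p q : ℂ, IsGiniPair p q ∧ ∃ k : ℝ, ∀ u ∈ I, ∀ v ∈ I,
      f u * g v - f v * g u = k * giniKernel p q u v := by
  -- Scale 1 suffices for the basis: the kernel ignores the scale, and positivity of the denominator
  -- is not needed here.
  suffices ∃ p q : ℂ, IsGiniPair p q ∧ ∃ φ' ψ' : ℝ → ℝ,
      IsEulerSolution I α β (giniNum 1 p q) φ' ∧ IsEulerSolution I α β (giniDen 1 p q) ψ' ∧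
      ∀ x ∈ I, φ' x * giniDen 1 p q x - giniNum 1 p q x * ψ' x ≠ 0 by
    obtain ⟨p, q, hpq, φ', ψ', hφ, hψ, hW⟩ := this
    obtain ⟨A, B, hf'⟩ := hf.exists_eq_linear_combination hIo hIc hI hφ hψ hW
    obtain ⟨A', B', hg'⟩ := hg.exists_eq_linear_combination hIo hIc hI hφ hψ hW
    refine ⟨p, q, hpq, A * B' - A' * B, fun u hu v hv => ?_⟩
    rw [giniKernel_eq one_pos p q (hI hu) (hI hv), hf' u hu, hf' v hv, hg' u hu, hg' v hv]
    ring
  -- The basis satisfies x Y' = AY with a constant 2×2 matrix A of trace 1+α and determinant -β. In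
  -- the three cases below A is a rotation-scaling block, a Jordan block or diagonal.
  suffices ∃ p q : ℂ, IsGiniPair p q ∧ ∃ a b c d : ℝ, a + d = 1 + α ∧ a * d - b * c = -β ∧
      (∀ x > 0, HasDerivAt (giniNum 1 p q) ((a * giniNum 1 p q x + b * giniDen 1 p q x) / x) x) ∧
      (∀ x > 0, HasDerivAt (giniDen 1 p q) ((c * giniNum 1 p q x + d * giniDen 1 p q x) / x) x) ∧
      ∀ x > 0, (a * giniNum 1 p q x + b * giniDen 1 p q x) * giniDen 1 p q x -
        giniNum 1 p q x * (c * giniNum 1 p q x + d * giniDen 1 p q x) ≠ 0 by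
    obtain ⟨p, q, hpq, a, b, c, d, htr, hdet, hN, hD, hW⟩ := this
    refine ⟨p, q, hpq, _, _,
      isEulerSolution_of_system hI (fun x hx => hN x (hI hx)) (fun x hx => hD x (hI hx)) htr hdet,
      isEulerSolution_of_system (a := d) (b := c) (c := b) (d := a) hI
        (fun x hx => (hD x (hI hx)).congr_deriv (by ring))
        (fun x hx => (hN x (hI hx)).congr_deriv (by ring)) (by linarith) (by linarith),
      fun x hx => ?_⟩
    have hx0 : x ≠ 0 := (hI hx).ne'
    have := div_ne_zero (hW x (hI hx)) hx0
    convert this using 1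
    ring
  have hrpow : ∀ p : ℝ, ∀ x > 0, HasDerivAt (fun x : ℝ => x ^ p) (p * x ^ p / x) x :=
    fun p x hx => by
      refine (Real.hasDerivAt_rpow_const (Or.inl (ne_of_gt hx))).congr_deriv ?_
      rw [Real.rpow_sub_one (ne_of_gt hx), mul_div_assoc]
  -- Trying y = x^r gives r² - (1+α)r - β = 0. This is its discriminant, and p, q are its roots.
  rcases lt_trichotomy ((1 + α) ^ 2 + 4 * β) 0 with hΔ | hΔ | hΔ
  · set s := √(-((1 + α) ^ 2 + 4 * β)) with hs
    have hs2 : s ^ 2 = -((1 + α) ^ 2 + 4 * β) := Real.sq_sqrt (by linarith)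
    have hs0 : 0 < s := Real.sqrt_pos.2 (by linarith)
    have hb : s / 2 ≠ 0 := by positivity
    set a := (1 + α) / 2
    set b := s / 2
    refine ⟨⟨a, b⟩, ⟨a, -b⟩, ⟨by simp, by simp; ring⟩, a, b, -b, a, by ring,
      by simp only [a, b]; linarith, ?_⟩
    have hN : giniNum 1 ⟨a, b⟩ ⟨a, -b⟩ = fun u => u ^ a * Real.sin (b * Real.log u) := by
      ext u; simp [giniNum, hb]
    have hD : giniDen 1 ⟨a, b⟩ ⟨a, -b⟩ = fun u => u ^ a * Real.cos (b * Real.log u) := by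
      ext u; simp [giniDen, hb]
    rw [hN, hD]
    refine ⟨fun x hx => ?_, fun x hx => ?_, fun x hx => ?_⟩
    · refine ((hrpow a x hx).mul
        ((Real.hasDerivAt_log (ne_of_gt hx)).const_mul b).sin).congr_deriv ?_
      field_simp
    · refine ((hrpow a x hx).mul
        ((Real.hasDerivAt_log (ne_of_gt hx)).const_mul b).cos).congr_deriv ?_
      field_simp
      ring
    · have hp : 0 < x ^ a := Real.rpow_pos_of_pos hx a
      have : b * (x ^ a) ^ 2 *
          (Real.sin (b * Real.log x) ^ 2 + Real.cos (b * Real.log x) ^ 2) ≠ 0 := by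
        rw [Real.sin_sq_add_cos_sq]
        positivity
      convert this using 1
      ring
  · set a := (1 + α) / 2
    refine ⟨⟨a, 0⟩, ⟨a, 0⟩, ⟨by simp, by simp⟩, a, 1, 0, a, by ring,
      by simp only [a]; linarith, ?_⟩
    have hN : giniNum 1 ⟨a, 0⟩ ⟨a, 0⟩ = fun u => u ^ a * Real.log u := by
      ext u; simp [giniNum]
    have hD : giniDen 1 ⟨a, 0⟩ ⟨a, 0⟩ = fun u => u ^ a := by
      ext u; simp [giniDen]
    rw [hN, hD]
    refine ⟨fun x hx => ?_, fun x hx => ?_, fun x hx => ?_⟩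
    · refine ((hrpow a x hx).mul (Real.hasDerivAt_log (ne_of_gt hx))).congr_deriv ?_
      field_simp
    · exact (hrpow a x hx).congr_deriv (by ring)
    · have hp : 0 < x ^ a := Real.rpow_pos_of_pos hx a
      have : (x ^ a) ^ 2 ≠ 0 := by positivity
      convert this using 1
      ring
  · set s := √((1 + α) ^ 2 + 4 * β) with hs
    have hs2 : s ^ 2 = (1 + α) ^ 2 + 4 * β := Real.sq_sqrt hΔ.le
    have hs0 : 0 < s := Real.sqrt_pos.2 hΔ
    set p := (1 + α + s) / 2
    set q := (1 + α - s) / 2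
    have hpq : p - q ≠ 0 := by
      have : p - q = s := by simp only [p, q]; ring
      rw [this]; exact hs0.ne'
    have hpq' : (⟨p, 0⟩ : ℂ) ≠ ⟨q, 0⟩ := fun h => hpq (by
      have := congrArg Complex.re h
      simpa [sub_eq_zero] using this)
    refine ⟨⟨p, 0⟩, ⟨q, 0⟩, ⟨by simp, by simp⟩, p, 0, 0, q, by simp only [p, q]; ring,
      by simp only [p, q]; linarith, ?_⟩
    have hN : giniNum 1 ⟨p, 0⟩ ⟨q, 0⟩ = fun u => u ^ p := by
      ext u; simp [giniNum, hpq']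
    have hD : giniDen 1 ⟨p, 0⟩ ⟨q, 0⟩ = fun u => u ^ q := by
      ext u; simp [giniDen, hpq']
    rw [hN, hD]
    refine ⟨fun x hx => ?_, fun x hx => ?_, fun x hx => ?_⟩
    · exact (hrpow p x hx).congr_deriv (by ring)
    · exact (hrpow q x hx).congr_deriv (by ring)
    · have hp : 0 < x ^ p := Real.rpow_pos_of_pos hx p
      have hq : 0 < x ^ q := Real.rpow_pos_of_pos hx q
      have : (p - q) * (x ^ p * x ^ q) ≠ 0 := mul_ne_zero hpq (by positivity)
      convert this using 1
      ring

/-- The kernel vanishes when v/u = exp(π/|b|), b = Im p, so I cannot contain two points with a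
larger ratio. -/
theorem exists_isGiniScale (hIo : IsOpen I) (hIc : I.OrdConnected) (hI : I ⊆ Ioi 0)
    (hne : I.Nonempty) {p q : ℂ} (hK : ∀ u ∈ I, ∀ v ∈ I, u ≠ v → giniKernel p q u v ≠ 0) :
    ∃ c, IsGiniScale I p c := by
  by_cases hp : p.im = 0
  · exact ⟨1, one_pos, fun h => absurd hp h⟩
  have hb : 0 < |p.im| := abs_pos.2 hp
  have hL : 0 < Real.pi / |p.im| := div_pos Real.pi_pos hb
  have hlen : ∀ u ∈ I, ∀ v ∈ I, v ≤ u * Real.exp (Real.pi / |p.im|) := by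
    intro u hu v hv
    by_contra! h
    have hu0 : 0 < u := hI hu
    have h1 : u < u * Real.exp (Real.pi / |p.im|) :=
      lt_mul_of_one_lt_right hu0 (Real.one_lt_exp_iff.2 hL)
    refine hK _ (hIc.out hu hv ⟨h1.le, h.le⟩) u hu h1.ne' ?_
    rw [giniKernel, if_neg hp, Real.log_mul hu0.ne' (Real.exp_ne_zero _), Real.log_exp,
      add_sub_cancel_left]
    rcases abs_choice p.im with h | h <;> rw [h]
    · rw [mul_div_cancel₀ _ hp, Real.sin_pi, mul_zero]
    · rw [div_neg, mul_neg, mul_div_cancel₀ _ hp, Real.sin_neg, Real.sin_pi, neg_zero, mul_zero]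
  obtain ⟨w, hw⟩ := hne
  have hw0 : 0 < w := hI hw
  have hba : BddAbove I := ⟨_, fun v hv => hlen w hw v hv⟩
  have hlt : ∀ u ∈ I, u < sSup I ∧ sSup I * Real.exp (-(Real.pi / |p.im|)) < u := by
    intro u hu
    -- Openness gives points of I on both sides of u, which makes both bounds strict.
    obtain ⟨ε, hε, hball⟩ := Metric.isOpen_iff.1 hIo u hu
    have h1 : u + ε / 2 ∈ I := hball (by
      rw [Metric.mem_ball, Real.dist_eq, abs_lt]; constructor <;> linarith)
    have h2 : u - ε / 2 ∈ I := hball (by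
      rw [Metric.mem_ball, Real.dist_eq, abs_lt]; constructor <;> linarith)
    refine ⟨by linarith [le_csSup hba h1], ?_⟩
    have h3 : sSup I ≤ (u - ε / 2) * Real.exp (Real.pi / |p.im|) :=
      csSup_le ⟨w, hw⟩ fun v hv => hlen _ h2 v hv
    rw [Real.exp_neg, ← div_eq_mul_inv, div_lt_iff₀ (Real.exp_pos _)]
    exact h3.trans_lt (mul_lt_mul_of_pos_right (by linarith) (Real.exp_pos _))
  have hS : 0 < sSup I := hw0.trans (hlt w hw).1
  -- This c puts the right end of the window at sup I and its left end at sup I · exp(-π/|b|).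
  refine ⟨sSup I * Real.exp (-(Real.pi / (2 * |p.im|))), by positivity, fun _ u hu => ?_⟩
  rw [mem_Ioo, mul_assoc, mul_assoc, ← Real.exp_add, ← Real.exp_add, neg_add_cancel,
    Real.exp_zero, mul_one]
  have h4 : -(Real.pi / (2 * |p.im|)) + -(Real.pi / (2 * |p.im|)) = -(Real.pi / |p.im|) := by
    field_simp
    ring
  rw [h4]
  exact ⟨(hlt u hu).2, (hlt u hu).1⟩

end Euler

/-! ### Third order expansion of the mean -/

/-- The functions `f₁, f₂, f₃` are the first three derivatives of `f` on `I`. -/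
structure HasThreeDerivs (I : Set ℝ) (f f₁ f₂ f₃ : ℝ → ℝ) : Prop where
  deriv₁ : ∀ x ∈ I, HasDerivAt f (f₁ x) x
  deriv₂ : ∀ x ∈ I, HasDerivAt f₁ (f₂ x) x
  deriv₃ : ∀ x ∈ I, HasDerivAt f₂ (f₃ x) x

theorem hasThreeDerivs_of_contDiffOn {I : Set ℝ} (hI : IsOpen I) {f : ℝ → ℝ}
    (hf : ContDiffOn ℝ 3 f I) :
    HasThreeDerivs I f (deriv f) (deriv (deriv f)) (deriv (deriv (deriv f))) := by
  have h1 : ContDiffOn ℝ 2 (deriv f) I := hf.deriv_of_isOpen hI (by norm_num)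
  have h2 : ContDiffOn ℝ 1 (deriv (deriv f)) I := h1.deriv_of_isOpen hI (by norm_num)
  have key : ∀ {n : WithTop ℕ∞} {h : ℝ → ℝ}, ContDiffOn ℝ n h I → n ≠ 0 →
      ∀ x ∈ I, HasDerivAt h (deriv h x) x := fun hh hn x hx =>
    ((hh.differentiableOn hn).differentiableAt (hI.mem_nhds hx)).hasDerivAt
  exact ⟨key hf (by norm_num), key h1 (by norm_num), key h2 (by norm_num)⟩

theorem centralMoment_coe_eq (μ : Measure unitInterval) (n : ℕ) :
    centralMoment (fun t : unitInterval => (t : ℝ)) n μ =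
      ∫ t : unitInterval, ((t : ℝ) - ∫ t : unitInterval, (t : ℝ) ∂μ) ^ n ∂μ := rfl

section Expansion

variable {I : Set ℝ} {f f₁ f₂ f₃ g g₁ g₂ g₃ : ℝ → ℝ} {z : ℝ}

/-- Peano's form of Taylor's theorem: start from differentiability of f₂ at z and integrate the
little-o estimate twice. -/
theorem HasThreeDerivs.isLittleO (hf : HasThreeDerivs I f f₁ f₂ f₃) (hIo : IsOpen I)
    (hIc : I.OrdConnected) (hz : z ∈ I) :
    (fun x => f x - f z - f₁ z * (x - z) - f₂ z / 2 * (x - z) ^ 2 - f₃ z / 6 * (x - z) ^ 3)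
      =o[𝓝 z] fun x => (x - z) ^ 3 := by
  have hn : 𝓝[I] z = 𝓝 z := hIo.nhdsWithin_eq hz
  have hpow : ∀ (n : ℕ) (x : ℝ),
      HasDerivAt (fun x : ℝ => (x - z) ^ n) (n * (x - z) ^ (n - 1)) x := fun n x => by
    simpa using ((hasDerivAt_id x).sub_const z).fun_pow n
  have h2 : (fun x => f₂ x - f₂ z - f₃ z * (x - z)) =o[𝓝[I] z] fun x => (x - z) ^ 1 := by
    rw [hn]
    simpa [mul_comm] using hasDerivAt_iff_isLittleO.1 (hf.deriv₃ z hz)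
  have h1 : (fun x => f₁ x - f₁ z - f₂ z * (x - z) - f₃ z / 2 * (x - z) ^ 2)
      =o[𝓝[I] z] fun x => (x - z) ^ 2 := by
    have := hIc.convex.isLittleO_pow_succ_real hz
      (f := fun x => f₁ x - f₂ z * (x - z) ^ 1 - f₃ z / 2 * (x - z) ^ 2) (fun x hx => ?_) h2
    · refine this.congr_left fun x => ?_
      simp only [sub_self]
      ring
    · refine ((((hf.deriv₂ x hx).sub ((hpow 1 x).const_mul _)).sub
        ((hpow 2 x).const_mul _)).congr_deriv ?_).hasDerivWithinAt
      simp
      ring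
  rw [← hn]
  have := hIc.convex.isLittleO_pow_succ_real hz
    (f := fun x => f x - f₁ z * (x - z) ^ 1 - f₂ z / 2 * (x - z) ^ 2 - f₃ z / 6 * (x - z) ^ 3)
    (fun x hx => ?_) h1
  · refine this.congr_left fun x => ?_
    simp only [sub_self]
    ring
  · refine (((((hf.deriv₁ x hx).sub ((hpow 1 x).const_mul _)).sub
      ((hpow 2 x).const_mul _)).sub ((hpow 3 x).const_mul _)).congr_deriv ?_).hasDerivWithinAt
    simp
    ring

theorem HasThreeDerivs.isBigO (hf : HasThreeDerivs I f f₁ f₂ f₃) (hIo : IsOpen I)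
    (hIc : I.OrdConnected) (hz : z ∈ I) :
    (fun x => f x - f z - f₁ z * (x - z)) =O[𝓝 z] fun x => (x - z) ^ 2 := by
  have h32 : (fun x => (x - z) ^ 3) =O[𝓝 z] fun x => (x - z) ^ 2 := by
    have : (fun x => x - z) =O[𝓝 z] fun _ => (1 : ℝ) :=
      ((continuous_id.sub continuous_const).tendsto z).isBigO_one ℝ
    exact (this.mul (isBigO_refl (fun x => (x - z) ^ 2) (𝓝 z))).congr
      (fun x => by ring) (fun x => by ring)
  have h := ((hf.isLittleO hIo hIc hz).isBigO.trans h32).add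
    (((isBigO_refl (fun x => (x - z) ^ 2) (𝓝 z)).const_mul_left (f₂ z / 2)).add
      (h32.const_mul_left (f₃ z / 6)))
  exact h.congr_left fun x => by ring

variable {μ : Measure unitInterval} [IsProbabilityMeasure μ]

theorem integral_coe_mem_unitInterval : ∫ t : unitInterval, (t : ℝ) ∂μ ∈ Icc (0 : ℝ) 1 := by
  refine ⟨integral_nonneg fun t => t.2.1, ?_⟩
  calc ∫ t : unitInterval, (t : ℝ) ∂μ ≤ ∫ _ : unitInterval, (1 : ℝ) ∂μ :=
        integral_mono (integrable_of_continuous_unitInterval continuous_subtype_val)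
          (integrable_const _) fun t => t.2.2
    _ = 1 := by simp

theorem segMean_centered (m s : ℝ) (t : unitInterval) :
    segMean (z + (1 - m) * s) (z - m * s) t = z + (t - m) * s := by
  unfold segMean
  ring

/-- Expansion of the average of `f` over a short segment centered at the barycenter `z`. -/
theorem HasThreeDerivs.integral_isLittleO (hf : HasThreeDerivs I f f₁ f₂ f₃) (hIo : IsOpen I)
    (hIc : I.OrdConnected) (hz : z ∈ I) {m : ℝ} (hm : m = ∫ t : unitInterval, (t : ℝ) ∂μ) :
    (fun s => (∫ t, f (segMean (z + (1 - m) * s) (z - m * s) t) ∂μ) - f z -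
      f₂ z / 2 * centralMoment (fun t : unitInterval => (t : ℝ)) 2 μ * s ^ 2 -
      f₃ z / 6 * centralMoment (fun t : unitInterval => (t : ℝ)) 3 μ * s ^ 3)
      =o[𝓝 0] fun s => s ^ 3 := by
  have hm01 : m ∈ Icc (0 : ℝ) 1 := hm ▸ integral_coe_mem_unitInterval
  have habs : ∀ t : unitInterval, |(t : ℝ) - m| ≤ 1 := fun t => by
    rw [abs_le]; constructor <;> linarith [t.2.1, t.2.2, hm01.1, hm01.2]
  rw [isLittleO_iff]
  intro c hc
  have hev := ((hf.isLittleO hIo hIc hz).def hc).and (hIo.mem_nhds hz)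
  obtain ⟨ε, hε, hball⟩ := Metric.eventually_nhds_iff.1 hev
  refine Metric.eventually_nhds_iff.2 ⟨ε, hε, fun s hs => ?_⟩
  rw [Real.dist_eq, sub_zero] at hs
  have hle : ∀ t : unitInterval, |((t : ℝ) - m) * s| ≤ |s| := fun t => by
    rw [abs_mul]
    exact mul_le_of_le_one_left (abs_nonneg s) (habs t)
  have hpt : ∀ t : unitInterval, dist (z + ((t : ℝ) - m) * s) z < ε := fun t => by
    rw [Real.dist_eq, add_sub_cancel_left]
    exact (hle t).trans_lt hs
  have hcont : Continuous fun t : unitInterval => f (z + ((t : ℝ) - m) * s) := by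
    have : ContinuousOn f I := fun x hx => (hf.deriv₁ x hx).continuousAt.continuousWithinAt
    exact this.comp_continuous (by fun_prop) fun t => (hball (hpt t)).2
  have hint : ∀ n : ℕ, Integrable (fun t : unitInterval => ((t : ℝ) - m) ^ n) μ := fun n =>
    integrable_of_continuous_unitInterval (by fun_prop)
  -- Centering at the barycenter kills the first order term.
  have h1 : ∫ t : unitInterval, ((t : ℝ) - m) ∂μ = 0 := by
    rw [integral_sub (integrable_of_continuous_unitInterval continuous_subtype_val)
      (integrable_const _), ← hm]
    simp
  have hi0 : Integrable (fun t : unitInterval => f (z + ((t : ℝ) - m) * s)) μ :=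
    integrable_of_continuous_unitInterval hcont
  have hi1 : Integrable (fun t : unitInterval => f₁ z * s * ((t : ℝ) - m)) μ :=
    integrable_of_continuous_unitInterval (by fun_prop)
  have hi2 : Integrable (fun t : unitInterval => f₂ z / 2 * s ^ 2 * ((t : ℝ) - m) ^ 2) μ :=
    (hint 2).const_mul _
  have hi3 : Integrable (fun t : unitInterval => f₃ z / 6 * s ^ 3 * ((t : ℝ) - m) ^ 3) μ :=
    (hint 3).const_mul _
  have hj0 : Integrable (fun t : unitInterval => f (z + ((t : ℝ) - m) * s) - f z) μ :=
    hi0.sub (integrable_const _)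
  have hj1 : Integrable (fun t : unitInterval =>
      f (z + ((t : ℝ) - m) * s) - f z - f₁ z * s * ((t : ℝ) - m)) μ := hj0.sub hi1
  have hj2 : Integrable (fun t : unitInterval => f (z + ((t : ℝ) - m) * s) - f z -
      f₁ z * s * ((t : ℝ) - m) - f₂ z / 2 * s ^ 2 * ((t : ℝ) - m) ^ 2) μ := hj1.sub hi2
  have heq : (∫ t, f (segMean (z + (1 - m) * s) (z - m * s) t) ∂μ) - f z -
      f₂ z / 2 * centralMoment (fun t : unitInterval => (t : ℝ)) 2 μ * s ^ 2 -
      f₃ z / 6 * centralMoment (fun t : unitInterval => (t : ℝ)) 3 μ * s ^ 3 =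
      ∫ t : unitInterval, (f (z + ((t : ℝ) - m) * s) - f z - f₁ z * s * ((t : ℝ) - m) -
        f₂ z / 2 * s ^ 2 * ((t : ℝ) - m) ^ 2 - f₃ z / 6 * s ^ 3 * ((t : ℝ) - m) ^ 3) ∂μ := by
    rw [integral_sub hj2 hi3, integral_sub hj1 hi2, integral_sub hj0 hi1,
      integral_sub hi0 (integrable_const _),
      integral_const_mul, integral_const_mul, integral_const_mul, h1, centralMoment_coe_eq,
      centralMoment_coe_eq, ← hm]
    simp only [segMean_centered, integral_const, probReal_univ, one_smul]
    ring
  rw [heq]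
  -- The Taylor remainder at t is at most c|(t-m)s|³ ≤ c|s|³, uniformly in t.
  refine (norm_integral_le_of_norm_le_const (C := c * ‖s ^ 3‖)
    (Eventually.of_forall fun t => ?_)).trans_eq (by simp)
  have := (hball (hpt t)).1
  simp only [add_sub_cancel_left] at this
  refine (le_of_eq ?_).trans (this.trans ?_)
  · congr 1
    ring
  · gcongr c * ?_
    rw [norm_pow, norm_pow]
    exact pow_le_pow_left₀ (norm_nonneg _) (hle t) 3

/-- Third order expansion of a function defined implicitly by balancing two averages. -/
theorem isLittleO_of_balance {F F₁ G G₁ A B A' B' : ℝ} {n γ δ ρ σ : ℝ → ℝ}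
    (hW : F₁ * G - F * G₁ ≠ 0)
    (hn : (fun s => n s - A * s ^ 2 - B * s ^ 3) =o[𝓝 0] fun s => s ^ 3)
    (hγ : (fun s => γ s - A' * s ^ 2 - B' * s ^ 3) =o[𝓝 0] fun s => s ^ 3)
    (hδ : δ =O[𝓝 0] fun s => s) (hρ : ρ =O[𝓝 0] fun s => δ s ^ 2)
    (hσ : σ =O[𝓝 0] fun s => δ s ^ 2)
    (h : ∀ᶠ s in 𝓝 0, (F + n s) * (G + G₁ * δ s + σ s) = (F + F₁ * δ s + ρ s) * (G + γ s)) :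
    (fun s => δ s - (A * G - F * A') / (F₁ * G - F * G₁) * s ^ 2 -
      (B * G - F * B') / (F₁ * G - F * G₁) * s ^ 3) =o[𝓝 0] fun s => s ^ 3 := by
  have hpow : ∀ {i j : ℕ}, i < j → (fun s : ℝ => s ^ j) =o[𝓝 0] fun s => s ^ i := fun hij =>
    isLittleO_pow_pow hij
  have hO2 : ∀ {k : ℝ → ℝ} {a b : ℝ},
      (fun s => k s - a * s ^ 2 - b * s ^ 3) =o[𝓝 0] (fun s => s ^ 3) →
      k =O[𝓝 0] fun s => s ^ 2 := fun {k a b} hk => by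
    have h32 := (hpow (show 2 < 3 by norm_num)).isBigO
    have := (hk.isBigO.trans h32).add
      (((isBigO_refl (fun s : ℝ => s ^ 2) (𝓝 0)).const_mul_left a).add (h32.const_mul_left b))
    exact this.congr_left fun s => by ring
  have hn2 := hO2 hn
  have hγ2 := hO2 hγ
  have hone : ∀ {k : ℝ → ℝ}, k =O[𝓝 0] (fun s : ℝ => s ^ 2) → k =o[𝓝 0] fun _ => (1 : ℝ) :=
    fun hk => hk.trans_isLittleO (by simpa using hpow (show 0 < 2 by norm_num))
  have hδ1 : δ =o[𝓝 0] fun _ => (1 : ℝ) :=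
    hδ.trans_isLittleO (by simpa using hpow (show 0 < 1 by norm_num))
  -- R collects the terms of the balance that are at least quadratic in the small quantities,
  -- leaving (F₁G - FG₁)δ = nG - Fγ + R. A bootstrap follows: δ = o(1) gives R = o(δ), hence δ =
  -- O(s²), hence R = O(s⁴).
  set R : ℝ → ℝ := fun s => δ s * (n s * G₁ - F₁ * γ s) + (F + n s) * σ s - (G + γ s) * ρ s
  have hid : ∀ᶠ s in 𝓝 0, (F₁ * G - F * G₁) * δ s - (n s * G - F * γ s) = R s := by
    filter_upwards [h] with s hs
    simp only [R]
    linear_combination -hs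
  have hng : (fun s => n s * G₁ - F₁ * γ s) =O[𝓝 0] fun s => s ^ 2 := by
    refine ((hn2.const_mul_left G₁).sub (hγ2.const_mul_left F₁)).congr_left fun s => by ring
  have hb : ∀ {k : ℝ → ℝ} (a : ℝ), k =O[𝓝 0] (fun s => s ^ 2) →
      (fun s => a + k s) =O[𝓝 0] fun _ => (1 : ℝ) := fun a hk =>
    (isBigO_const_const a one_ne_zero _).add (hone hk).isBigO
  have hRbig : ∀ {k : ℝ → ℝ}, (fun s => δ s * s ^ 2) =O[𝓝 0] k →
      (fun s => δ s ^ 2) =O[𝓝 0] k → R =O[𝓝 0] k := fun hk1 hk2 => by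
    refine ((((isBigO_refl δ (𝓝 0)).mul hng).trans hk1).add ?_).sub ?_
    · exact (((hb F hn2).mul hσ).congr_right fun s => one_mul _).trans hk2
    · exact (((hb G hγ2).mul hρ).congr_right fun s => one_mul _).trans hk2
  have hRδ : R =o[𝓝 0] δ := by
    have h1 : (fun s => δ s * s ^ 2) =o[𝓝 0] δ := by
      simpa using (isBigO_refl δ (𝓝 0)).mul_isLittleO (hone (isBigO_refl _ _))
    have h2 : (fun s => δ s ^ 2) =o[𝓝 0] δ := by
      simpa [sq] using (isBigO_refl δ (𝓝 0)).mul_isLittleO hδ1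
    have h3 : R =O[𝓝 0] fun s => |δ s * s ^ 2| + |δ s ^ 2| := by
      refine hRbig ?_ ?_
      · exact IsBigO.of_bound 1 (Eventually.of_forall fun s => by
          rw [Real.norm_eq_abs, Real.norm_eq_abs, one_mul]
          exact (le_add_of_nonneg_right (abs_nonneg _)).trans (le_abs_self _))
      · exact IsBigO.of_bound 1 (Eventually.of_forall fun s => by
          rw [Real.norm_eq_abs, Real.norm_eq_abs, one_mul]
          exact (le_add_of_nonneg_left (abs_nonneg _)).trans (le_abs_self _))
    exact h3.trans_isLittleO (h1.abs_left.add h2.abs_left)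
  have hδ2 : δ =O[𝓝 0] fun s => s ^ 2 := by
    have hE : (fun s => n s * G - F * γ s) =O[𝓝 0] fun s => s ^ 2 := by
      refine ((hn2.const_mul_left G).sub (hγ2.const_mul_left F)).congr_left fun s => by ring
    have h1 : R =o[𝓝 0] fun s => (F₁ * G - F * G₁) * δ s := hRδ.const_mul_right hW
    have h2 := h1.right_isBigO_sub
    refine ((isBigO_refl δ (𝓝 0)).const_mul_right hW).trans (h2.trans ?_)
    refine hE.congr' ?_ EventuallyEq.rfl
    filter_upwards [hid] with s hs
    linarith
  have hR3 : R =o[𝓝 0] fun s => s ^ 3 := by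
    refine IsBigO.trans_isLittleO (g := fun s => s ^ 4) (hRbig ?_ ?_) (hpow (by norm_num))
    · exact (hδ2.mul (isBigO_refl _ _)).congr_right fun s => by ring
    · exact (hδ2.pow 2).congr_right fun s => by ring
  have hfin := ((hR3.add (hn.const_mul_left G)).sub (hγ.const_mul_left F)).const_mul_left
    (F₁ * G - F * G₁)⁻¹
  refine hfin.congr' ?_ EventuallyEq.rfl
  filter_upwards [hid] with s hs
  rw [← hs]
  field_simp
  ring

theorem bajMean_isLittleO (hIo : IsOpen I) (hIc : I.OrdConnected)
    (hf : HasThreeDerivs I f f₁ f₂ f₃) (hg : HasThreeDerivs I g g₁ g₂ g₃)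
    (hfg : IsChebyshevSystem I f g) (hg0 : ∀ u ∈ I, g u ≠ 0) (hz : z ∈ I)
    (hW : f₁ z * g z - f z * g₁ z ≠ 0) {m : ℝ} (hm : m = ∫ t : unitInterval, (t : ℝ) ∂μ) :
    (fun s => bajMean I f g μ (z + (1 - m) * s) (z - m * s) - z -
      centralMoment (fun t : unitInterval => (t : ℝ)) 2 μ / 2 *
        ((f₂ z * g z - f z * g₂ z) / (f₁ z * g z - f z * g₁ z)) * s ^ 2 -
      centralMoment (fun t : unitInterval => (t : ℝ)) 3 μ / 6 *
        ((f₃ z * g z - f z * g₃ z) / (f₁ z * g z - f z * g₁ z)) * s ^ 3)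
      =o[𝓝 0] fun s => s ^ 3 := by
  have hm01 : m ∈ Icc (0 : ℝ) 1 := hm ▸ integral_coe_mem_unitInterval
  set δ : ℝ → ℝ := fun s => bajMean I f g μ (z + (1 - m) * s) (z - m * s) - z with hδ
  have hmem : ∀ᶠ s in 𝓝 (0 : ℝ), z + (1 - m) * s ∈ I ∧ z - m * s ∈ I := by
    refine Eventually.and ?_ ?_
    · have : ContinuousAt (fun s => z + (1 - m) * s) 0 := by fun_prop
      exact this.eventually_mem (by simpa using hIo.mem_nhds hz)
    · have : ContinuousAt (fun s => z - m * s) 0 := by fun_prop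
      exact this.eventually_mem (by simpa using hIo.mem_nhds hz)
  have hδO : δ =O[𝓝 0] fun s => s := by
    -- The mean lies between the two endpoints, each within |s| of z; this a priori bound starts the
    -- bootstrap.
    refine IsBigO.of_bound 1 ?_
    filter_upwards [hmem] with s hs
    have h := (exists_bajMean_balance (μ := μ) hIc hfg hg0 hs.1 hs.2).1
    have hX : |(1 - m) * s| ≤ |s| := by
      rw [abs_mul]
      exact mul_le_of_le_one_left (abs_nonneg s)
        (abs_le.2 ⟨by linarith [hm01.2], by linarith [hm01.1]⟩)
    have hY : |m * s| ≤ |s| := by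
      rw [abs_mul]
      exact mul_le_of_le_one_left (abs_nonneg s)
        (abs_le.2 ⟨by linarith [hm01.1], by linarith [hm01.2]⟩)
    rw [abs_le] at hX hY
    rw [one_mul, Real.norm_eq_abs, Real.norm_eq_abs, abs_le]
    rw [mem_uIcc] at h
    simp only [δ]
    rcases h with h | h <;> constructor <;> linarith [h.1, h.2]
  have htend : Tendsto (fun s => z + δ s) (𝓝 0) (𝓝 z) := by
    have : Tendsto δ (𝓝 0) (𝓝 0) := hδO.trans_tendsto tendsto_id
    simpa using this.const_add z
  have hρ := (hf.isBigO hIo hIc hz).comp_tendsto htend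
  have hσ := (hg.isBigO hIo hIc hz).comp_tendsto htend
  simp only [Function.comp_def, add_sub_cancel_left] at hρ hσ
  have hn := hf.integral_isLittleO (μ := μ) hIo hIc hz hm
  have hγ := hg.integral_isLittleO (μ := μ) hIo hIc hz hm
  refine (isLittleO_of_balance hW hn hγ hδO hρ hσ ?_).congr_left fun s => ?_
  · filter_upwards [hmem] with s hs
    have h := (exists_bajMean_balance (μ := μ) hIc hfg hg0 hs.1 hs.2).2
    have hzδ : z + δ s = bajMean I f g μ (z + (1 - m) * s) (z - m * s) := by
      simp only [δ]
      ring
    rw [← hzδ] at h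
    linear_combination h
  · simp only [δ]
    ring

end Expansion

/-! ### From homogeneity to the Euler equation -/

theorem eq_zero_of_isLittleO_pow {a b : ℝ}
    (h : (fun s : ℝ => a * s ^ 2 + b * s ^ 3) =o[𝓝 0] fun s => s ^ 3) : a = 0 ∧ b = 0 := by
  have key : ∀ {n : ℕ} {k : ℝ}, (fun s : ℝ => k * s ^ n) =o[𝓝 0] (fun s => s ^ n) → k = 0 := by
    intro n k hk
    have hk' := hk.mono (nhdsWithin_le_nhds (s := {0}ᶜ))
    have h1 := hk'.tendsto_div_nhds_zero
    have h2 : Tendsto (fun s : ℝ => k * s ^ n / s ^ n) (𝓝[≠] 0) (𝓝 k) := by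
      refine tendsto_const_nhds.congr' ?_
      filter_upwards [self_mem_nhdsWithin] with s hs
      have : s ≠ 0 := hs
      field_simp
    exact tendsto_nhds_unique h2 h1
  have h32 : (fun s : ℝ => s ^ 3) =o[𝓝 0] fun s => s ^ 2 := isLittleO_pow_pow (by norm_num)
  have ha : a = 0 := by
    refine key (n := 2) (((h.trans h32).sub (h32.const_mul_left b)).congr_left fun s => ?_)
    ring
  subst ha
  exact ⟨rfl, key (n := 3) (h.congr_left fun s => by ring)⟩

section Homogeneous

variable {I : Set ℝ} {f f₁ f₂ f₃ g g₁ g₂ g₃ : ℝ → ℝ} {μ : Measure unitInterval}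
  [IsProbabilityMeasure μ]

/-- Homogeneity of the mean scales the two invariants in its third order expansion. -/
theorem IsHomogeneousMean.invariants_mul (hIo : IsOpen I) (hIc : I.OrdConnected) (hI : I ⊆ Ioi 0)
    (hf : HasThreeDerivs I f f₁ f₂ f₃) (hg : HasThreeDerivs I g g₁ g₂ g₃)
    (hfg : IsChebyshevSystem I f g) (hg0 : ∀ u ∈ I, g u ≠ 0)
    (hW : ∀ u ∈ I, f₁ u * g u - f u * g₁ u ≠ 0)
    (hμ2 : centralMoment (fun t : unitInterval => (t : ℝ)) 2 μ ≠ 0)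
    (hμ3 : centralMoment (fun t : unitInterval => (t : ℝ)) 3 μ ≠ 0)
    (hM : IsHomogeneousMean I (bajMean I f g μ)) {z w : ℝ} (hz : z ∈ I) (hw : w ∈ I) :
    w * ((f₂ w * g w - f w * g₂ w) / (f₁ w * g w - f w * g₁ w)) =
        z * ((f₂ z * g z - f z * g₂ z) / (f₁ z * g z - f z * g₁ z)) ∧
      w ^ 2 * ((f₃ w * g w - f w * g₃ w) / (f₁ w * g w - f w * g₁ w)) =
        z ^ 2 * ((f₃ z * g z - f z * g₃ z) / (f₁ z * g z - f z * g₁ z)) := by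
  have hz0 : 0 < z := hI hz
  have hw0 : 0 < w := hI hw
  obtain ⟨m, hm⟩ : ∃ m, m = ∫ t : unitInterval, (t : ℝ) ∂μ := ⟨_, rfl⟩
  have h₁ := bajMean_isLittleO (μ := μ) hIo hIc hf hg hfg hg0 hz (hW z hz) hm
  have h₂ := bajMean_isLittleO (μ := μ) hIo hIc hf hg hfg hg0 hw (hW w hw) hm
  set P := fun u => (f₂ u * g u - f u * g₂ u) / (f₁ u * g u - f u * g₁ u)
  set T := fun u => (f₃ u * g u - f u * g₃ u) / (f₁ u * g u - f u * g₁ u)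
  set c₂ := centralMoment (fun t : unitInterval => (t : ℝ)) 2 μ
  set c₃ := centralMoment (fun t : unitInterval => (t : ℝ)) 3 μ
  change (fun s => bajMean I f g μ (z + (1 - m) * s) (z - m * s) - z - c₂ / 2 * P z * s ^ 2 -
    c₃ / 6 * T z * s ^ 3) =o[𝓝 0] _ at h₁
  change (fun s => bajMean I f g μ (w + (1 - m) * s) (w - m * s) - w - c₂ / 2 * P w * s ^ 2 -
    c₃ / 6 * T w * s ^ 3) =o[𝓝 0] _ at h₂
  change w * P w = z * P z ∧ w ^ 2 * T w = z ^ 2 * T z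
  obtain ⟨l, hl⟩ : ∃ l, l = w / z := ⟨_, rfl⟩
  have hl0 : 0 < l := hl ▸ div_pos hw0 hz0
  have hlw : l * z = w := by rw [hl]; field_simp
  have hlI : l ∈ I / I := hl ▸ Set.div_mem_div hw hz
  have hmem : ∀ {v : ℝ} (a b : ℝ), v ∈ I → ∀ᶠ s in 𝓝 (0 : ℝ), v + a * (b * s) ∈ I := by
    intro v a b hv
    have : ContinuousAt (fun s => v + a * (b * s)) 0 := by fun_prop
    exact this.eventually_mem (by simpa using hIo.mem_nhds hv)
  have htend : Tendsto (fun s : ℝ => l * s) (𝓝 0) (𝓝 0) := by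
    simpa using (tendsto_id (x := 𝓝 (0 : ℝ))).const_mul l
  -- The segment around z at parameter s, dilated by l = w/z, is the segment around w at parameter l
  -- s.
  have h₃ : (fun s => bajMean I f g μ (w + (1 - m) * (l * s)) (w - m * (l * s)) - w -
      c₂ / 2 * P w * (l * s) ^ 2 - c₃ / 6 * T w * (l * s) ^ 3) =o[𝓝 0] fun s => s ^ 3 :=
    (h₂.comp_tendsto htend).trans_isBigO
      (((isBigO_refl (fun s : ℝ => s ^ 3) (𝓝 0)).const_mul_left (l ^ 3)).congr_left
        fun s => by simp only [Function.comp_apply]; ring)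
  have hdiff : (fun s : ℝ => (c₂ / 2 * (l ^ 2 * P w - l * P z)) * s ^ 2 +
      (c₃ / 6 * (l ^ 3 * T w - l * T z)) * s ^ 3) =o[𝓝 0] fun s => s ^ 3 := by
    refine ((h₁.const_mul_left l).sub h₃).congr' ?_ EventuallyEq.rfl
    filter_upwards [hmem (1 - m) 1 hz, hmem (-m) 1 hz, hmem (1 - m) l hw, hmem (-m) l hw]
      with s hs₁ hs₂ hs₃ hs₄
    have e₁ : z + (1 - m) * (1 * s) = z + (1 - m) * s := by ring
    have e₂ : z + -m * (1 * s) = z - m * s := by ring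
    have e₃ : w + (1 - m) * (l * s) = l * (z + (1 - m) * s) := by rw [← hlw]; ring
    have e₄ : w - m * (l * s) = l * (z - m * s) := by rw [← hlw]; ring
    have e₅ : w + -m * (l * s) = l * (z - m * s) := by rw [← hlw]; ring
    rw [e₁] at hs₁
    rw [e₂] at hs₂
    rw [e₃] at hs₃
    rw [e₅] at hs₄
    rw [e₃, e₄, hM l hlI _ hs₁ _ hs₂ hs₃ hs₄, ← hlw]
    ring
  obtain ⟨ha, hb⟩ := eq_zero_of_isLittleO_pow hdiff
  have ha' : l * (l * P w - P z) = 0 := by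
    have := (mul_eq_zero.1 ha).resolve_left (div_ne_zero hμ2 two_ne_zero)
    linear_combination this
  have hb' : l * (l ^ 2 * T w - T z) = 0 := by
    have := (mul_eq_zero.1 hb).resolve_left (div_ne_zero hμ3 (by norm_num))
    linear_combination this
  have ha'' := (mul_eq_zero.1 ha').resolve_left hl0.ne'
  have hb'' := (mul_eq_zero.1 hb').resolve_left hl0.ne'
  constructor
  · rw [← hlw] at ha'' ⊢
    linear_combination z * ha''
  · rw [← hlw] at hb'' ⊢
    linear_combination z ^ 2 * hb''

/-- The determinants of order two and three of a pair of functions determine an Euler equation. -/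
theorem isEulerSolution_of_determinants (hIo : IsOpen I) (hI : I ⊆ Ioi 0)
    (hf : HasThreeDerivs I f f₁ f₂ f₃) (hg : HasThreeDerivs I g g₁ g₂ g₃)
    (hW : ∀ u ∈ I, f₁ u * g u - f u * g₁ u ≠ 0) {α θ : ℝ}
    (hα : ∀ u ∈ I, f₂ u * g u - f u * g₂ u = α / u * (f₁ u * g u - f u * g₁ u))
    (hθ : ∀ u ∈ I, f₃ u * g u - f u * g₃ u = θ / u ^ 2 * (f₁ u * g u - f u * g₁ u)) :
    IsEulerSolution I α (α + θ - α ^ 2) f f₁ ∧ IsEulerSolution I α (α + θ - α ^ 2) g g₁ := by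
  have key : ∀ u ∈ I, f₂ u = α / u * f₁ u + (α + θ - α ^ 2) / u ^ 2 * f u ∧
      g₂ u = α / u * g₁ u + (α + θ - α ^ 2) / u ^ 2 * g u := by
    intro u hu
    have hu0 : u ≠ 0 := (hI hu).ne'
    -- The derivative of f₂g - fg₂ is computed directly and through `hα`; equating the two
    -- determines f₂g₁ - f₁g₂ as a multiple of the Wronskian.
    have hd₁ := ((hf.deriv₃ u hu).fun_mul (hg.deriv₁ u hu)).fun_sub
      ((hf.deriv₁ u hu).fun_mul (hg.deriv₃ u hu))
    have hd₂ := ((hasDerivAt_const u α).fun_div (hasDerivAt_id' u) hu0).fun_mul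
      (((hf.deriv₂ u hu).fun_mul (hg.deriv₁ u hu)).fun_sub
        ((hf.deriv₁ u hu).fun_mul (hg.deriv₂ u hu)))
    have hd₃ := hd₂.congr_of_eventuallyEq (f₁ := fun u => f₂ u * g u - f u * g₂ u)
      (Filter.eventually_of_mem (hIo.mem_nhds hu) hα)
    have he := hd₁.unique hd₃
    have h1 := hα u hu
    have h2 := hθ u hu
    have hV : f₂ u * g₁ u - f₁ u * g₂ u =
        -((α + θ - α ^ 2) / u ^ 2) * (f₁ u * g u - f u * g₁ u) := by
      have h3 : (0 * u - α * 1) / u ^ 2 = -(α / u ^ 2) := by ring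
      rw [h3] at he
      have h4 : (α + θ - α ^ 2) / u ^ 2 = α / u ^ 2 + θ / u ^ 2 - (α / u) ^ 2 := by ring
      rw [h4]
      linear_combination he - h2 + α / u * h1
    -- With W = f₁g - fg₁, f₂W = f₁(f₂g - fg₂) - f(f₂g₁ - f₁g₂), and similarly for g₂.
    constructor <;> refine mul_right_cancel₀ (hW u hu) ?_
    · linear_combination f₁ u * h1 - f u * hV
    · linear_combination g₁ u * h1 - g u * hV
  exact ⟨⟨hf.deriv₁, fun u hu => (hf.deriv₂ u hu).congr_deriv (key u hu).1⟩,
    ⟨hg.deriv₁, fun u hu => (hg.deriv₂ u hu).congr_deriv (key u hu).2⟩⟩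

/-- Proportional kernels have the same averaged zero. -/
theorem bajMean_eq_giniMean (hIc : I.OrdConnected) (hI : I ⊆ Ioi 0)
    (hfg : IsChebyshevSystem I f g) (hg0 : ∀ u ∈ I, g u ≠ 0) {p q : ℂ} {c k : ℝ}
    (hpq : IsGiniPair p q) (hc : IsGiniScale I p c)
    (hk : ∀ u ∈ I, ∀ v ∈ I, f u * g v - f v * g u = k * giniKernel p q u v) {x y : ℝ}
    (hx : x ∈ I) (hy : y ∈ I) : bajMean I f g μ x y = giniMean μ c p q x y := by
  obtain ⟨h1, h2⟩ := giniMean_mem_and_integral_eq_zero (μ := μ) hI hIc hpq hc hx hy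
  have hs := hIc.uIcc_subset hx hy
  set ξ := giniMean μ c p q x y
  refine bajMean_eq_of_balance hIc hfg hg0 hx hy (hs h1) ?_
  rw [← sub_eq_zero, ← integral_mul_const, ← integral_const_mul, ← integral_sub
    ((integrable_comp_segMean (hfg.1.mono hs)).mul_const _)
    ((integrable_comp_segMean (hfg.2.1.mono hs)).const_mul _)]
  have : ∀ t, f (segMean x y t) * g ξ - f ξ * g (segMean x y t) =
      k * giniKernel p q (segMean x y t) ξ := fun t =>
    hk _ (hs (segMean_mem_uIcc x y t)) _ (hs h1)
  simp only [this, integral_const_mul, h2, mul_zero]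

end Homogeneous

end Development

theorem mainTheorem11 (I : Set ℝ) (hI_open : IsOpen I) (hI_conn : I.OrdConnected)
    (hI_ne : I.Nonempty) (hI_pos : I ⊆ Set.Ioi 0)
    (f g : ℝ → ℝ) (hfg : IsChebyshevClass 3 I f g) (hg : ∀ x ∈ I, g x ≠ 0)
    (μ : MeasureTheory.Measure unitInterval) [MeasureTheory.IsProbabilityMeasure μ]
    (hμ2 : ProbabilityTheory.centralMoment (fun t : unitInterval => (t : ℝ)) 2 μ ≠ 0)
    (hμ3 : ProbabilityTheory.centralMoment (fun t : unitInterval => (t : ℝ)) 3 μ ≠ 0) :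
    (IsHomogeneousMean I (bajMean I f g μ) ↔
      ∃ p q : ℂ, IsGiniPair p q ∧ ∃ c : ℝ, IsGiniScale I p c ∧
        ∀ x ∈ I, ∀ y ∈ I, bajMean I f g μ x y = giniMean μ c p q x y) ∧
    (∀ p q : ℂ, IsGiniPair p q → ∀ c : ℝ, IsGiniScale I p c →
      (∀ x ∈ I, ∀ y ∈ I, bajMean I f g μ x y = giniMean μ c p q x y) →
      ∀ c' : ℝ, IsGiniScale I p c' →
        ∀ x ∈ I, ∀ y ∈ I, bajMean I f g μ x y = giniMean μ c' p q x y) := by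

  have hIc := hI_conn
  refine ⟨⟨fun hM => ?_, ?_⟩, ?_⟩
  · have hf := hasThreeDerivs_of_contDiffOn hI_open hfg.contDiffOn_left
    have hg' := hasThreeDerivs_of_contDiffOn hI_open hfg.contDiffOn_right
    have hW := hfg.wronskian_ne_zero (by norm_num)
    obtain ⟨z, hz⟩ := hI_ne
    -- With z fixed, the values of the two invariants at z serve as the constants α and θ.
    have hinv := fun u (hu : u ∈ I) => hM.invariants_mul hI_open hIc hI_pos hf hg' hfg.chebyshev
      hg hW hμ2 hμ3 hz hu
    obtain ⟨hEf, hEg⟩ := isEulerSolution_of_determinants hI_open hI_pos hf hg' hW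
      (fun u hu => by
        have hu0 : u ≠ 0 := (hI_pos hu).ne'
        rw [← div_eq_iff (hW u hu), eq_div_iff hu0, mul_comm]
        exact (hinv u hu).1)
      (fun u hu => by
        have hu0 : u ≠ 0 := (hI_pos hu).ne'
        rw [← div_eq_iff (hW u hu), eq_div_iff (pow_ne_zero 2 hu0), mul_comm]
        exact (hinv u hu).2)
    obtain ⟨p, q, hpq, k, hk⟩ := hEf.exists_giniKernel hI_open hIc hI_pos hEg
    -- The Chebyshev determinant is k times the kernel, so the kernel has no zeros off the diagonal.
    obtain ⟨c, hc⟩ := exists_isGiniScale hI_open hIc hI_pos ⟨z, hz⟩ (p := p) (q := q)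
      fun u hu v hv huv h0 => hfg.chebyshev.2.2 u hu v hv huv (by
        rw [hk u hu v hv, h0, mul_zero])
    exact ⟨p, q, hpq, c, hc, fun x hx y hy =>
      bajMean_eq_giniMean hIc hI_pos hfg.chebyshev hg hpq hc hk hx hy⟩
  · rintro ⟨p, q, hpq, c, hc, h⟩ l ⟨u, hu, v, hv, rfl⟩ x hx y hy hlx hly
    have hl : 0 < u / v := div_pos (hI_pos hu) (hI_pos hv)
    rw [h _ hlx _ hly, h x hx y hy]
    exact giniMean_mul hI_pos hIc hpq hc hx hy hl hlx hly
  · intro p q hpq c hc h c' hc' x hx y hy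
    rw [h x hx y hy, giniMean_eq_giniMean hI_pos hIc hpq hc hc' hx hy]
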